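/- Let $m$ be a positive integer, $q=2^m$, and let $h$ be a proper divisor of $m$ such that $m/h$ is odd; assume $m\neq 3$ (in particular every even $m$ having such an $h$ is allowed). Let $\mathrm{Tr}$ be the trace from $\mathbb F_q$ to $\mathbb F_2$. For $a\in\mathbb F_2$ let $$D_a=\{x\in\mathbb F_q^*:\ \mathrm{Tr}(x^{2^h+1}+x)=a\}=\{d_1,\dots,d_{n_a}\}$$ and let $C_{D_a}=\{(\mathrm{Tr}(xd_1),\dots,\mathrm{Tr}(xd_{n_a})):\ x\in\mathbb F_q\}$ be the binary code with defining set $D_a$. Let $\left(\frac{2}{m/h}\right)$ be the Jacobi symbol and put $\varepsilon=\left(\frac{2}{m/h}\right)^h$; in the formulas $a$ is read as the integer $0$ or $1$. Then $C_{D_a}$ is an $[n_a,m]$ binary linear code, where $$n_a=2^{m-1}+(-1)^a\,\varepsilon\,2^{\frac{m+h-2}{2}}+a-1,$$ it is a three-weight code, that is, exactly three positive weights occur, and its weight distribution is $$\begin{array}{l|l} \text{Weight} & \text{Multiplicity}\\ \hline 0 & 1\\ 2^{m-2} & 2^{m-h-1}-1+\varepsilon\,2^{\frac{m-h-2}{2}}\\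 2^{m-2}+(-1)^a\,\varepsilon\,2^{\frac{m+h-2}{2}} & 2^{m-h-1}-\varepsilon\,2^{\frac{m-h-2}{2}}\\ 2^{m-2}+(-1)^a\,\varepsilon\,2^{\frac{m+h-4}{2}} & 2^m-2^{m-h} \end{array}$$ where the four weights are distinct and no other weight occurs. -/

import Mathlib

section Codes

/-- The binary code with defining set `D`: all vectors `(Tr (x d))`, `d ∈ D`, for `x ∈ F`, where
`Tr` is the trace from `F` to `𝔽₂`. The coordinates are indexed by the elements of `D`, so the
length of the code is the cardinality of `D`. -/
noncomputable def traceCode {F : Type*} [Field F] [Algebra (ZMod 2) F] (D : Finset F) :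
    Submodule (ZMod 2) (D → ZMod 2) where
  carrier := Set.range fun x : F => fun d : D => Algebra.trace (ZMod 2) F (x * (d : F))
  zero_mem' := ⟨0, by ext d; simp⟩
  add_mem' := by
    rintro _ _ ⟨x, rfl⟩ ⟨y, rfl⟩
    exact ⟨x + y, by ext d; simp [add_mul]⟩
  smul_mem' := by
    rintro c _ ⟨x, rfl⟩
    exact ⟨c • x, by ext d; simp⟩

open Classical in
/-- The set of nonzero `x ∈ F` with `Tr (x ^ (2 ^ h + 1) + x) = a`. -/
noncomputable def definingSet (F : Type*) [Field F] [Fintype F] [Algebra (ZMod 2) F]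
    (h : ℕ) (a : ZMod 2) : Finset F :=
  Finset.univ.filter fun x : F =>
    x ≠ 0 ∧ Algebra.trace (ZMod 2) F (x ^ (2 ^ h + 1) + x) = a

/-- `C` has length `n` and dimension `k`, that is, `C` is an `[n, k]` binary linear code
(lengths and dimensions are compared in `ℤ`, where the formulas for them are evaluated). -/
def IsLinearCode {ι : Type*} [Fintype ι] (C : Submodule (ZMod 2) (ι → ZMod 2)) (n k : ℤ) : Prop :=
  (Fintype.card ι : ℤ) = n ∧ (Module.finrank (ZMod 2) C : ℤ) = k

/-- The number `A i` of codewords of `C` of Hamming weight `i`. -/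
noncomputable def weightCount {ι : Type*} [Fintype ι] (C : Submodule (ZMod 2) (ι → ZMod 2))
    (i : ℕ) : ℕ :=
  {c : ι → ZMod 2 | c ∈ C ∧ hammingNorm c = i}.ncard

/-- `C` is a `t`-weight code: exactly `t` of the numbers `A 1, …, A n` are nonzero, where `n` is
the length of `C`. -/
def IsWeightCode {ι : Type*} [Fintype ι] (C : Submodule (ZMod 2) (ι → ZMod 2)) (t : ℕ) : Prop :=
  {i : ℕ | 1 ≤ i ∧ i ≤ Fintype.card ι ∧ weightCount C i ≠ 0}.ncard = t

end Codes

/-! Write `S(b)` for the Weil sum `goldSum F h b` and `k = m/h`. Expanding indicators in the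
character `(-1)^Tr` shows that the codeword of `x ≠ 0` has weight `(q + (-1)^a (S(1) - S(1+x)))/4`,
so everything reduces to the values of `S`.

Squaring (`goldSum_sq`) leaves a sum over the radical of the polar form of `Tr(x^(2^h+1))`. As `k`
is odd, the radical is the field of order `2^h`, where the summand is an additive character; hence
`S(b)^2` is `0` or `2^(m+h)`. The moments of `S` of order 0, 1, 2 then give the frequency of each
value (`card_goldSum_eq`).

The sign of `S(1)` remains (`goldSum_one`). For a prime `p ∣ k`, a Frobenius power of order `p`
fixes exactly a subfield `L` of index `p`, so `S_F(1) ≡ S_L(1)` mod `p`; Euler's criterion for 2 mod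
`p` and induction on `k` yield the Jacobi symbol. -/

namespace TraceCode

/-! ### Subfields as fixed fields of Frobenius powers -/

section FixedField
variable {F : Type*} [Field F] [Fintype F] [Algebra (ZMod 2) F]

/-- A finite field of order `2 ^ m` has, for each divisor `d` of `m`, a subfield of order `2 ^ d`,
consisting of the `x` with `x ^ 2 ^ d = x`. -/
theorem exists_intermediateField {m d : ℕ} (hF : Fintype.card F = 2 ^ m) (hm : 0 < m)
    (hd : d ∣ m) : ∃ L : IntermediateField (ZMod 2) F,
      (∀ x, x ∈ L ↔ x ^ 2 ^ d = x) ∧ Nat.card L = 2 ^ d ∧ Module.finrank L F = m / d := by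
  have hfin : Module.finrank (ZMod 2) F = m := by
    have := Module.card_eq_pow_finrank (K := ZMod 2) (V := F)
    rw [hF, ZMod.card] at this
    exact (Nat.pow_right_injective le_rfl this).symm
  set φ := FiniteField.frobeniusAlgEquivOfAlgebraic (ZMod 2) F with hφ
  have hord : orderOf φ = m := by
    rw [hφ, FiniteField.orderOf_frobeniusAlgEquivOfAlgebraic, hfin]
  have hpow : ∀ x, (φ ^ d) x = x ^ 2 ^ d := by
    intro x
    rw [AlgEquiv.coe_pow, hφ, FiniteField.coe_frobeniusAlgEquivOfAlgebraic_iterate, ZMod.card]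
  have hd0 : 0 < d := Nat.pos_of_dvd_of_pos hd hm
  have hfr : Module.finrank (IntermediateField.fixedField (Subgroup.zpowers (φ ^ d))) F = m / d := by
    rw [IntermediateField.finrank_fixedField_eq_card, Nat.card_zpowers,
      orderOf_pow_of_dvd hd0.ne' (hord ▸ hd), hord]
  refine ⟨IntermediateField.fixedField (Subgroup.zpowers (φ ^ d)), fun x => ?_, ?_, hfr⟩
  · rw [IntermediateField.mem_fixedField_iff]
    constructor
    · intro hx
      rw [← hpow]
      exact hx _ (Subgroup.mem_zpowers _)
    · intro hx f hf
      rw [← hpow] at hx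
      have : Subgroup.zpowers (φ ^ d) ≤ MulAction.stabilizer Gal(F/ZMod 2) x := by
        rw [Subgroup.zpowers_le]
        exact hx
      exact this hf
  · set L := IntermediateField.fixedField (Subgroup.zpowers (φ ^ d))
    have h1 : Module.finrank (ZMod 2) L * (m / d) = m := by
      rw [← hfr, Module.finrank_mul_finrank, hfin]
    have h2 : Module.finrank (ZMod 2) L = d := by
      obtain ⟨k, rfl⟩ := hd
      rw [Nat.mul_div_cancel_left _ hd0] at h1
      exact Nat.eq_of_mul_eq_mul_right (Nat.pos_of_mul_pos_left hm) h1
    rw [Module.natCard_eq_pow_finrank (K := ZMod 2), h2, Nat.card_zmod]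

end FixedField

/-- The nontrivial additive character of `ZMod 2`. -/
def signChar : AddChar (ZMod 2) ℤ where
  toFun a := (-1) ^ a.val
  map_zero_eq_one' := by simp
  map_add_eq_mul' := by decide

/-! ### Trace character, moments and square of the Weil sum -/

section Char
variable (F : Type*) [Field F] [Algebra (ZMod 2) F]

/-- The additive character `x ↦ (-1) ^ Tr x` of an extension of `ZMod 2`. -/
noncomputable def traceChar : AddChar F ℤ :=
  signChar.compAddMonoidHom (Algebra.trace (ZMod 2) F).toAddMonoidHom

variable {F}

theorem traceChar_apply (x : F) : traceChar F x = signChar (Algebra.trace (ZMod 2) F x) := rfl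

variable [Fintype F]

theorem trace_pow_two_pow (n : ℕ) (x : F) :
    Algebra.trace (ZMod 2) F (x ^ 2 ^ n) = Algebra.trace (ZMod 2) F x := by
  have h := Algebra.trace_eq_of_algEquiv
    ((FiniteField.frobeniusAlgEquivOfAlgebraic (ZMod 2) F) ^ n) x
  rwa [AlgEquiv.coe_pow, FiniteField.coe_frobeniusAlgEquivOfAlgebraic_iterate, ZMod.card] at h

theorem traceChar_isPrimitive : (traceChar F).IsPrimitive := by
  intro a ha h
  obtain ⟨y, hy⟩ := Algebra.trace_surjective (ZMod 2) F 1
  have := DFunLike.congr_fun h (a⁻¹ * y)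
  rw [AddChar.mulShift_apply, mul_inv_cancel_left₀ ha, traceChar_apply, hy, AddChar.one_apply] at this
  exact absurd this (by decide)

theorem sum_traceChar_mul [DecidableEq F] (b : F) :
    ∑ x, traceChar F (x * b) = if b = 0 then (Fintype.card F : ℤ) else 0 := by
  simpa using AddChar.sum_mulShift b traceChar_isPrimitive

/-- The Weil sum of `x ^ (2 ^ h + 1) + b * x`. -/
noncomputable def goldSum (F : Type*) [Field F] [Algebra (ZMod 2) F] [Fintype F]
    (h : ℕ) (b : F) : ℤ :=
  ∑ x : F, traceChar F (x ^ (2 ^ h + 1) + b * x)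

theorem sum_goldSum (h : ℕ) : ∑ b : F, goldSum F h b = Fintype.card F := by
  classical
  unfold goldSum
  rw [Finset.sum_comm]
  simp_rw [AddChar.map_add_eq_mul, ← Finset.mul_sum, sum_traceChar_mul]
  simp

omit [Fintype F] in
theorem charP_two : CharP F 2 := charP_of_injective_algebraMap (algebraMap (ZMod 2) F).injective 2

theorem sum_goldSum_sq (h : ℕ) : ∑ b : F, goldSum F h b ^ 2 = (Fintype.card F : ℤ) ^ 2 := by
  classical
  have : CharP F 2 := charP_two
  unfold goldSum
  simp_rw [sq, Finset.sum_mul_sum]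
  rw [Finset.sum_comm]
  simp_rw [Finset.sum_comm (s := (Finset.univ : Finset F)) (t := (Finset.univ : Finset F))
    (f := fun b y => traceChar F (_ + b * _) * traceChar F (y ^ (2 ^ h + 1) + b * y))]
  have key : ∀ x y b : F, traceChar F (x ^ (2 ^ h + 1) + b * x) *
      traceChar F (y ^ (2 ^ h + 1) + b * y) =
      traceChar F (x ^ (2 ^ h + 1) + y ^ (2 ^ h + 1)) * traceChar F (b * (x + y)) := by
    intro x y b
    rw [← AddChar.map_add_eq_mul, ← AddChar.map_add_eq_mul]
    congr 1; ring
  simp_rw [key, ← Finset.mul_sum, sum_traceChar_mul, CharTwo.add_eq_zero]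
  simp [CharTwo.add_self_eq_zero]

/-- Frobenius invariance of the trace lets the second term be raised to the power `2 ^ h`; the polar
form becomes linear in `x ^ 2 ^ h`, which exposes its radical. -/
theorem trace_polar_eq (h : ℕ) (x y : F) :
    Algebra.trace (ZMod 2) F (x ^ 2 ^ h * y + x * y ^ 2 ^ h) =
      Algebra.trace (ZMod 2) F (x ^ 2 ^ h * (y + y ^ 2 ^ (2 * h))) := by
  rw [map_add, ← trace_pow_two_pow h (x * y ^ 2 ^ h), ← map_add]
  congr 1
  rw [two_mul h, pow_add 2 h h, pow_mul]
  ring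

theorem sum_traceChar_polar [DecidableEq F] (h : ℕ) (y : F) :
    ∑ x, traceChar F (x ^ 2 ^ h * y + x * y ^ 2 ^ h) =
      if y ^ 2 ^ (2 * h) = y then (Fintype.card F : ℤ) else 0 := by
  have : CharP F 2 := charP_two
  have hb : Function.Bijective fun x : F => x ^ 2 ^ h :=
    bijective_iterateFrobenius F 2 h
  have : ∀ x : F, traceChar F (x ^ 2 ^ h * y + x * y ^ 2 ^ h) =
      traceChar F (x ^ 2 ^ h * (y + y ^ 2 ^ (2 * h))) := fun x => by
    rw [traceChar_apply, trace_polar_eq, traceChar_apply]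
  simp_rw [this]
  rw [hb.sum_comp fun z => traceChar F (z * (y + y ^ 2 ^ (2 * h))), sum_traceChar_mul]
  simp only [CharTwo.add_eq_zero, eq_comm (a := y) (b := y ^ 2 ^ (2 * h))]

/-- Replacing the second variable by `x + y` leaves `x` only in the polar form, and the sum over `x`
vanishes unless `y` lies in the radical. -/
theorem goldSum_sq [DecidableEq F] (h : ℕ) (b : F) : goldSum F h b ^ 2 = (Fintype.card F : ℤ) *
    ∑ y with y ^ 2 ^ (2 * h) = y, traceChar F (y ^ (2 ^ h + 1) + b * y) := by
  have : CharP F 2 := charP_two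
  have key : ∀ x y : F, traceChar F (x ^ (2 ^ h + 1) + b * x) *
      traceChar F ((x + y) ^ (2 ^ h + 1) + b * (x + y)) =
      traceChar F (y ^ (2 ^ h + 1) + b * y) * traceChar F (x ^ 2 ^ h * y + x * y ^ 2 ^ h) := by
    intro x y
    rw [← AddChar.map_add_eq_mul, ← AddChar.map_add_eq_mul]
    congr 1
    rw [pow_succ (x + y), add_pow_char_pow]
    -- The terms in `x` alone occur twice and cancel in characteristic 2.
    linear_combination (x ^ (2 ^ h + 1) + b * x) * CharTwo.two_eq_zero (R := F)
  rw [sq]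
  unfold goldSum
  rw [Finset.sum_mul]
  simp_rw [Finset.mul_sum]
  calc _ = ∑ x : F, ∑ y : F, traceChar F (x ^ (2 ^ h + 1) + b * x) *
      traceChar F ((x + y) ^ (2 ^ h + 1) + b * (x + y)) := by
        refine Finset.sum_congr rfl fun x _ => ?_
        exact (Equiv.sum_comp (Equiv.addLeft x) fun z => traceChar F (x ^ (2 ^ h + 1) + b * x) *
          traceChar F (z ^ (2 ^ h + 1) + b * z)).symm
    _ = _ := by
        rw [Finset.sum_comm]
        simp_rw [key, ← Finset.mul_sum, sum_traceChar_polar]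
        rw [Finset.sum_filter, Finset.mul_sum]
        refine Finset.sum_congr rfl fun y _ => ?_
        split_ifs <;> simp [mul_comm]

end Char

/-! ### Absolute value of the Weil sum -/

section Abs
variable {F : Type*} [Field F] [Fintype F] [Algebra (ZMod 2) F]

omit [Fintype F] [Algebra (ZMod 2) F] in
theorem pow_two_pow_mul_eq_self {h : ℕ} {y : F} (hy : y ^ 2 ^ h = y) (n : ℕ) :
    y ^ 2 ^ (h * n) = y := by
  induction n with
  | zero => simp
  | succ n ih => rw [mul_add, mul_one, pow_add, pow_mul, ih, hy]

omit [Algebra (ZMod 2) F] in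
theorem pow_two_pow_two_mul_eq_self_iff {h j : ℕ} (hF : Fintype.card F = 2 ^ (h * (2 * j + 1)))
    (y : F) : y ^ 2 ^ (2 * h) = y ↔ y ^ 2 ^ h = y := by
  constructor
  · intro hy
    have h1 := FiniteField.pow_card y
    -- In `y ^ q = y`, the first `2hj` Frobenius steps act trivially on `y`, leaving `h` of them.
    rwa [hF, show h * (2 * j + 1) = 2 * h * j + h by ring, pow_add, pow_mul,
      pow_two_pow_mul_eq_self hy] at h1
  · intro hy
    rw [mul_comm]
    exact pow_two_pow_mul_eq_self hy 2

/-- On the radical `y ^ (2 ^ h + 1) = y ^ 2` has the same trace as `y`, so the quadratic form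
becomes linear. -/
theorem goldSum_sq_eq_sum [DecidableEq F] {h j : ℕ} (hF : Fintype.card F = 2 ^ (h * (2 * j + 1)))
    (b : F) : goldSum F h b ^ 2 = 2 ^ (h * (2 * j + 1)) *
      ∑ y with y ^ 2 ^ h = y, traceChar F ((1 + b) * y) := by
  rw [goldSum_sq, hF]
  simp_rw [pow_two_pow_two_mul_eq_self_iff hF]
  push_cast
  congr 1
  refine Finset.sum_congr rfl fun y hy => ?_
  have hy : y ^ 2 ^ h = y := by simpa using hy
  rw [add_mul, one_mul, AddChar.map_add_eq_mul, AddChar.map_add_eq_mul, pow_succ, hy, ← sq]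
  congr 1
  have := trace_pow_two_pow 1 y
  rw [pow_one] at this
  rw [traceChar_apply, this, traceChar_apply]

theorem goldSum_one_sq {h j : ℕ} (hh : 0 < h) (hF : Fintype.card F = 2 ^ (h * (2 * j + 1))) :
    goldSum F h 1 ^ 2 = (2 ^ (h * (j + 1))) ^ 2 := by
  classical
  have : CharP F 2 := charP_two
  obtain ⟨L, hL, hc, -⟩ := exists_intermediateField hF (by positivity) (Dvd.intro _ rfl)
  rw [goldSum_sq_eq_sum hF]
  simp only [CharTwo.add_self_eq_zero, zero_mul, AddChar.map_zero_eq_one, Finset.sum_const,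
    nsmul_eq_mul, mul_one]
  have : (Finset.univ.filter fun y : F => y ^ 2 ^ h = y).card = 2 ^ h := by
    refine Eq.trans ?_ hc
    rw [Nat.card_eq_fintype_card, Fintype.card_subtype]
    simp only [hL]
  rw [this]
  push_cast
  ring

/-- A character of the subfield of order `2 ^ h` sums to `2 ^ h` if trivial and to `0` otherwise. -/
theorem goldSum_sq_eq_zero_or {h j : ℕ} (hh : 0 < h)
    (hF : Fintype.card F = 2 ^ (h * (2 * j + 1))) (b : F) :
    goldSum F h b ^ 2 = 0 ∨ goldSum F h b ^ 2 = (2 ^ (h * (j + 1))) ^ 2 := by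
  classical
  obtain ⟨L, hL, hc, -⟩ := exists_intermediateField hF (by positivity) (Dvd.intro _ rfl)
  rw [goldSum_sq_eq_sum hF]
  have : ∑ y with y ^ 2 ^ h = y, traceChar F ((1 + b) * y) =
      ∑ y : L, (((traceChar F).mulShift (1 + b)).compAddMonoidHom L.val.toAddMonoidHom) y := by
    simp_rw [← hL]
    rw [← Finset.sum_subtype_eq_sum_filter]
    exact Finset.sum_congr (by ext; simp) fun y _ => rfl
  rw [this, AddChar.sum_eq_ite]
  split_ifs
  · right
    rw [← Nat.card_eq_fintype_card, hc]
    push_cast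
    ring
  · simp

end Abs

/-! ### Sign of the Weil sum at 1 -/

section Sign

/-- The map `x ↦ x ^ 2 ^ d` has `p`-th iterate the identity, so its orbits have size 1 or `p`. -/
theorem card_subtype_modEq_fixed {F : Type*} [Field F] [Fintype F] {d p : ℕ} [Fact p.Prime]
    (hF : Fintype.card F = 2 ^ (d * p)) (P : F → Prop) (hP : ∀ x, P x → P (x ^ 2 ^ d)) :
    Nat.card {x // P x} ≡ Nat.card {x // P x ∧ x ^ 2 ^ d = x} [MOD p] := by
  classical
  let f : Function.End {x // P x} := fun x => ⟨x.1 ^ 2 ^ d, hP _ x.2⟩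
  have hf : ∀ n x, ((f ^ n) x).1 = x.1 ^ 2 ^ (d * n) := by
    intro n
    induction n with
    | zero => intro x; simp [show (1 : Function.End {x // P x}) x = x from rfl]
    | succ n ih =>
      intro x
      rw [pow_succ]
      change ((f ^ n) (f x)).1 = _
      rw [ih, ← pow_mul, ← pow_add, mul_add, mul_one, add_comm d]
  have h1 : f ^ p ^ 1 = 1 := by
    funext x
    refine Subtype.ext ?_
    rw [hf, pow_one, ← hF, FiniteField.pow_card]
    rfl
  have := Equiv.Perm.card_fixedPoints_modEq h1
  rw [Nat.card_eq_fintype_card]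
  refine this.trans ?_
  rw [← Nat.card_eq_fintype_card]
  rw [Nat.card_congr ((Equiv.subtypeEquivRight fun x => ?_).trans
    (Equiv.subtypeSubtypeEquivSubtypeInter P fun x => x ^ 2 ^ d = x))]
  exact Subtype.ext_iff

theorem goldSum_eq_card {F : Type*} [Field F] [Fintype F] [Algebra (ZMod 2) F] (h : ℕ) (b : F) :
    goldSum F h b = 2 * Nat.card {x : F // Algebra.trace (ZMod 2) F (x ^ (2 ^ h + 1) + b * x) = 0}
      - Fintype.card F := by
  classical
  have key : ∀ a : ZMod 2, signChar a = 2 * (if a = 0 then 1 else 0) - 1 := by decide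
  unfold goldSum
  simp_rw [traceChar_apply, key]
  rw [Finset.sum_sub_distrib, ← Finset.mul_sum, Nat.card_eq_fintype_card, Fintype.card_subtype]
  simp

theorem goldSum_one_modEq {F : Type*} [Field F] [Fintype F] [Algebra (ZMod 2) F] {d p : ℕ}
    [Fact p.Prime] (hp : Odd p) (hF : Fintype.card F = 2 ^ (d * p)) (L : IntermediateField (ZMod 2) F)
    [Fintype L] (hL : ∀ x, x ∈ L ↔ x ^ 2 ^ d = x) (hfr : Module.finrank L F = p) (h : ℕ) :
    (goldSum F h 1 : ZMod p) = (goldSum L h 1 : ZMod p) := by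
  have h1 := card_subtype_modEq_fixed hF
    (fun x => Algebra.trace (ZMod 2) F (x ^ (2 ^ h + 1) + 1 * x) = 0) (fun x hx => by
      rw [← hx, ← trace_pow_two_pow d (x ^ (2 ^ h + 1) + 1 * x)]
      have : CharP F 2 := charP_two
      rw [add_pow_char_pow]
      congr 1; ring)
  have h2 := card_subtype_modEq_fixed hF (fun _ => True) (fun _ _ => trivial)
  have e2 : Nat.card {x : F // True ∧ x ^ 2 ^ d = x} = Fintype.card L := by
    rw [← Nat.card_eq_fintype_card]
    exact Nat.card_congr (Equiv.subtypeEquivRight fun x => by simp [hL])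
  have e1 : Nat.card {x : F // Algebra.trace (ZMod 2) F (x ^ (2 ^ h + 1) + 1 * x) = 0 ∧
      x ^ 2 ^ d = x} =
      Nat.card {x : L // Algebra.trace (ZMod 2) L (x ^ (2 ^ h + 1) + 1 * x) = 0} := by
    have htr : ∀ x : L, Algebra.trace (ZMod 2) F (x : F) = Algebra.trace (ZMod 2) L x := by
      intro x
      rw [← Algebra.trace_trace (S := L), ← IntermediateField.algebraMap_apply,
        Algebra.trace_algebraMap, hfr, map_nsmul, nsmul_eq_mul]
      -- Both traces agree on `L` because the degree `p` is odd.
      rw [(ZMod.natCast_eq_one_iff_odd).2 hp, one_mul]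
    refine Nat.card_congr (((Equiv.subtypeEquivRight fun x => ?_).trans
      (Equiv.subtypeSubtypeEquivSubtypeInter (· ∈ L)
        fun x => Algebra.trace (ZMod 2) F (x ^ (2 ^ h + 1) + 1 * x) = 0).symm).trans
      (Equiv.subtypeEquivRight fun x => ?_))
    · rw [hL, and_comm]
    · rw [← htr]; simp
  rw [e2, Nat.card_congr (Equiv.subtypeUnivEquiv fun _ => trivial), Nat.card_eq_fintype_card] at h2
  rw [e1] at h1
  rw [goldSum_eq_card, goldSum_eq_card]
  rw [← ZMod.natCast_eq_natCast_iff] at h1 h2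
  push_cast
  rw [h1, h2]

universe u

/-- The absolute value is known and `p` is odd, so the residue mod a prime factor `p` of `k`
determines the sign; that residue comes from the subfield of index `p`. -/
theorem goldSum_one (h : ℕ) (hh : 0 < h) (k : ℕ) (j : ℕ) (hk : k = 2 * j + 1) (F : Type u) [Field F]
    [Fintype F] [Algebra (ZMod 2) F] (hF : Fintype.card F = 2 ^ (h * k)) :
    goldSum F h 1 = jacobiSym 2 k ^ h * 2 ^ (h * (j + 1)) := by
  induction k using Nat.strong_induction_on generalizing j F with
  | _ k ih =>
  by_cases hk1 : k = 1
  · obtain rfl : j = 0 := by omega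
    subst hk1
    rw [jacobiSym.one_right]
    -- Here `F` has order `2 ^ h`, and the argument is `x ^ 2 + x`, of trace zero.
    have : ∀ x : F, traceChar F (x ^ (2 ^ h + 1) + 1 * x) = 1 := by
      intro x
      have hx := FiniteField.pow_card x
      rw [hF, mul_one] at hx
      have := trace_pow_two_pow 1 x
      rw [pow_one] at this
      rw [pow_succ, hx, one_mul, traceChar_apply, map_add, ← sq, this, CharTwo.add_self_eq_zero,
        AddChar.map_zero_eq_one]
    unfold goldSum
    simp_rw [this]
    simp [hF]
  · obtain ⟨k', hk'⟩ := Nat.minFac_dvd k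
    have hp : k.minFac.Prime := Nat.minFac_prime hk1
    set p := k.minFac
    have : Fact p.Prime := ⟨hp⟩
    have hkodd : Odd k := ⟨j, hk⟩
    rw [hk', Nat.odd_mul] at hkodd
    obtain ⟨hpo, hko⟩ := hkodd
    obtain ⟨i, hi⟩ := hpo
    obtain ⟨j', hj'⟩ := hko
    have hd : h * k = h * k' * p := by rw [hk']; ring
    have hk'0 : 0 < k' := by omega
    obtain ⟨L, hL, hc, hfr⟩ := exists_intermediateField (d := h * k') hF
      (by rw [hd]; have := hp.pos; positivity) (Dvd.intro _ hd.symm)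
    rw [hd, Nat.mul_div_cancel_left _ (by positivity)] at hfr
    have : Fintype L := Fintype.ofFinite L
    have hmod := goldSum_one_modEq ⟨i, hi⟩ (hd ▸ hF) L hL hfr h
    have hlt : k' < k := by rw [hk']; nlinarith [hp.two_le]
    have hIH := ih k' hlt j' hj' L (by rw [← hc, Nat.card_eq_fintype_card])
    have hjj : j + 1 = (j' + 1) + i * k' := by
      have : 2 * j + 1 = (2 * i + 1) * (2 * j' + 1) := by rw [← hk, ← hi, ← hj', ← hk']
      rw [hj']; nlinarith
    have hJ : jacobiSym 2 k = jacobiSym 2 p * jacobiSym 2 k' := by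
      conv_lhs => rw [hk']
      exact jacobiSym.mul_right' _ hp.ne_zero hk'0.ne'
    have hcop : ∀ n : ℕ, Odd n → jacobiSym 2 n = 1 ∨ jacobiSym 2 n = -1 := fun n hn =>
      jacobiSym.eq_one_or_neg_one (by
        have : Nat.Coprime 2 n := Nat.coprime_two_left.2 hn
        exact_mod_cast this)
    have hleg : (2 : ZMod p) ^ i = (jacobiSym 2 p : ZMod p) := by
      have := legendreSym.eq_pow p 2
      rw [jacobiSym.legendreSym.to_jacobiSym, show p / 2 = i by omega] at this
      rw [this]; norm_cast
    have h2 : (2 : ZMod p) ≠ 0 := by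
      intro h0
      have : ((2 : ℕ) : ZMod p) = 0 := by exact_mod_cast h0
      rw [ZMod.natCast_eq_zero_iff] at this
      have := Nat.le_of_dvd two_pos this
      have := hp.two_le
      omega
    have hk'e : ∀ e : ℤ, (e = 1 ∨ e = -1) → e ^ k' = e := by
      rintro e (rfl | rfl)
      · simp
      · exact Odd.neg_one_pow ⟨j', hj'⟩
    have hsgn : ∀ e : ℤ, (e = 1 ∨ e = -1) → (e ^ h = 1 ∨ e ^ h = -1) := by
      rintro e (rfl | rfl)
      · simp
      · exact neg_one_pow_eq_or ℤ h
    have hA := hsgn _ (hcop p ⟨i, hi⟩)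
    have hB := hsgn _ (hcop k' ⟨j', hj'⟩)
    -- With `p = 2i + 1`, the surplus factor is `(2 ^ i) ^ (k' * h)`; Euler's criterion applies to
    -- `2 ^ i`, and the odd exponent `k'` does not affect a sign.
    have hpw : (2 : ZMod p) ^ (h * (j + 1)) =
        2 ^ (h * (j' + 1)) * ((jacobiSym 2 p ^ h : ℤ) : ZMod p) := by
      rw [hjj, mul_add, pow_add, show h * (i * k') = i * k' * h by ring, pow_mul _ (i * k'),
        pow_mul _ i, hleg]
      congr 1
      rw [← Int.cast_pow, ← Int.cast_pow, hk'e _ (hcop p ⟨i, hi⟩)]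
    rw [hIH] at hmod
    rw [hJ, mul_pow]
    have h2' : (2 : ZMod p) ^ (h * (j' + 1)) ≠ 0 := pow_ne_zero _ h2
    have h11 : (1 : ZMod p) ≠ -1 := by
      intro h0
      apply h2
      linear_combination h0
    obtain ⟨s, hs1, hs⟩ : ∃ s : ℤ, (s = 1 ∨ s = -1) ∧ goldSum F h 1 = s * 2 ^ (h * (j + 1)) := by
      rcases sq_eq_sq_iff_eq_or_eq_neg.1 (goldSum_one_sq hh (hk ▸ hF)) with hs | hs
      · exact ⟨1, by simp, by rw [hs, one_mul]⟩
      · exact ⟨-1, by simp, by rw [hs, neg_one_mul]⟩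
    rw [hs] at hmod ⊢
    generalize jacobiSym 2 p ^ h = A at *
    generalize jacobiSym 2 k' ^ h = B at *
    congr 1
    have hAB : (s : ZMod p) * A = B := by
      apply mul_right_cancel₀ h2'
      push_cast at hmod
      rw [← hmod, hpw]
      ring
    rcases hs1 with rfl | rfl <;> rcases hA with rfl | rfl <;> rcases hB with rfl | rfl <;>
      simp [h11, h11.symm] at hAB ⊢

end Sign

/-! ### Value distribution of the Weil sum -/

section Count
variable {F : Type*} [Field F] [Fintype F] [Algebra (ZMod 2) F]

theorem sum_comp_eq_of_mem_three {ι : Type*} [Fintype ι] (S : ι → ℤ) {M : ℤ} (hM : M ≠ 0)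
    (hS : ∀ b, S b = 0 ∨ S b = M ∨ S b = -M) (g : ℤ → ℤ) : ∑ b, g (S b) =
      g 0 * Nat.card {b // S b = 0} + g M * Nat.card {b // S b = M}
        + g (-M) * Nat.card {b // S b = -M} := by
  classical
  have hM' : M ≠ -M := by omega
  have : ∀ b, g (S b) = g 0 * (if S b = 0 then 1 else 0) + g M * (if S b = M then 1 else 0)
      + g (-M) * (if S b = -M then 1 else 0) := by
    intro b
    rcases hS b with h | h | h <;> rw [h] <;> simp [hM, hM.symm, hM', hM'.symm]
  simp_rw [this, Finset.sum_add_distrib, ← Finset.mul_sum, Nat.card_eq_fintype_card,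
    Fintype.card_subtype]
  simp

theorem goldSum_mem {h j : ℕ} (hh : 0 < h)
    (hF : Fintype.card F = 2 ^ (h * (2 * j + 1))) (b : F) :
    goldSum F h b = 0 ∨ goldSum F h b = 2 ^ (h * (j + 1)) ∨
      goldSum F h b = -2 ^ (h * (j + 1)) := by
  rcases goldSum_sq_eq_zero_or hh hF b with hb | hb
  · exact Or.inl (pow_eq_zero_iff two_ne_zero |>.1 hb)
  · exact Or.inr (sq_eq_sq_iff_eq_or_eq_neg.1 hb)

/-- Three moments give a linear system for the three frequencies. The factor 2 avoids an exponent
`2hj - 1`, which would fail at `j = 0`. -/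
theorem card_goldSum_eq {h j : ℕ} (hh : 0 < h) (hF : Fintype.card F = 2 ^ (h * (2 * j + 1))) :
    (Nat.card {b // goldSum F h b = 0} : ℤ) = 2 ^ (h * (2 * j + 1)) - 2 ^ (2 * (h * j)) ∧
    (∀ e : ℤ, e = 1 ∨ e = -1 → 2 * (Nat.card {b // goldSum F h b = e * 2 ^ (h * (j + 1))} : ℤ) =
      2 ^ (2 * (h * j)) + e * 2 ^ (h * j)) := by
  have hM : (2 : ℤ) ^ (h * (j + 1)) ≠ 0 := by positivity
  have h0 := sum_comp_eq_of_mem_three _ hM (goldSum_mem hh hF) fun _ => 1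
  have h1 := sum_comp_eq_of_mem_three _ hM (goldSum_mem hh hF) id
  have h2 := sum_comp_eq_of_mem_three _ hM (goldSum_mem hh hF) (· ^ 2)
  simp only [id, sum_goldSum, sum_goldSum_sq, hF] at h0 h1 h2
  simp only [Finset.sum_const, Finset.card_univ, hF] at h0
  set A := Nat.card {b // goldSum F h b = 0}
  set B := Nat.card {b // goldSum F h b = 2 ^ (h * (j + 1))}
  set C := Nat.card {b // goldSum F h b = -2 ^ (h * (j + 1))}
  have e1 : (2 : ℤ) ^ (h * (2 * j + 1)) = 2 ^ (h * (j + 1)) * 2 ^ (h * j) := by ring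
  push_cast at h0 h1 h2
  have h1' : (B : ℤ) - C = 2 ^ (h * j) := by
    apply mul_left_cancel₀ hM
    linear_combination e1 - h1
  have h2' : (B : ℤ) + C = 2 ^ (2 * (h * j)) := by
    apply mul_left_cancel₀ (pow_ne_zero 2 hM)
    rw [e1] at h2
    rw [two_mul (h * j), pow_add]
    linear_combination -h2
  refine ⟨by simp only [nsmul_eq_mul] at h0; push_cast at h0; linear_combination -h0 - h2', ?_⟩
  rintro e (rfl | rfl)
  · simp only [one_mul]
    linear_combination h1' + h2'
  · simp only [neg_one_mul]
    linear_combination h2' - h1'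

end Count

/-! ### Weights and length in terms of the Weil sum -/

section Code
variable {F : Type*} [Field F] [Algebra (ZMod 2) F]

/-- The encoding map of `traceCode D`. -/
noncomputable def codeword (D : Finset F) : F →ₗ[ZMod 2] (D → ZMod 2) where
  toFun x d := Algebra.trace (ZMod 2) F (x * (d : F))
  map_add' x y := by ext d; simp [add_mul]
  map_smul' c x := by ext d; simp

theorem range_codeword (D : Finset F) : LinearMap.range (codeword D) = traceCode D := rfl

variable [Fintype F]

theorem hammingNorm_codeword (h : ℕ) (a : ZMod 2) (x : F) :
    hammingNorm (codeword (definingSet F h a) x) =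
      Nat.card {d : F // Algebra.trace (ZMod 2) F (d ^ (2 ^ h + 1) + d) = a ∧
        Algebra.trace (ZMod 2) F (x * d) ≠ 0} := by
  classical
  rw [hammingNorm, ← Fintype.card_subtype, ← Nat.card_eq_fintype_card]
  refine Nat.card_congr ((Equiv.subtypeSubtypeEquivSubtypeInter (· ∈ definingSet F h a)
    fun d => Algebra.trace (ZMod 2) F (x * d) ≠ 0).trans (Equiv.subtypeEquivRight fun d => ?_))
  simp only [definingSet, Finset.mem_filter, Finset.mem_univ, true_and]
  constructor
  · rintro ⟨⟨-, h1⟩, h2⟩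
    exact ⟨h1, h2⟩
  · rintro ⟨h1, h2⟩
    refine ⟨⟨?_, h1⟩, h2⟩
    rintro rfl
    simp at h2

theorem four_mul_hammingNorm_codeword (h : ℕ) (a : ZMod 2) {x : F} (hx : x ≠ 0) :
    4 * (hammingNorm (codeword (definingSet F h a) x) : ℤ) =
      Fintype.card F + (-1) ^ a.val * (goldSum F h 1 - goldSum F h (1 + x)) := by
  classical
  -- This is the expansion of `(1 + (-1)^a χ(t)) (1 - χ(s))`, with `χ` the sign character.
  have key : ∀ t s : ZMod 2, 4 * (if t = a ∧ s ≠ 0 then 1 else 0 : ℤ) =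
      1 + (-1) ^ a.val * signChar t - signChar s - (-1) ^ a.val * (signChar t * signChar s) := by
    revert a; decide
  have h0 := sum_traceChar_mul x
  rw [if_neg hx] at h0
  have h1 : ∑ d : F, 4 * (if Algebra.trace (ZMod 2) F (d ^ (2 ^ h + 1) + d) = a ∧
        Algebra.trace (ZMod 2) F (x * d) ≠ 0 then 1 else 0 : ℤ) =
      Fintype.card F + (-1) ^ a.val * (goldSum F h 1 - goldSum F h (1 + x)) := by
    simp_rw [key, ← traceChar_apply, ← AddChar.map_add_eq_mul]
    simp_rw [Finset.sum_sub_distrib, Finset.sum_add_distrib, ← Finset.mul_sum, mul_comm x, h0]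
    unfold goldSum
    simp only [one_mul, add_mul, mul_comm x, add_assoc, Finset.sum_const, Finset.card_univ,
      nsmul_eq_mul, mul_one]
    ring
  rw [← h1, ← Finset.mul_sum, hammingNorm_codeword, Nat.card_eq_fintype_card, Fintype.card_subtype]
  simp

theorem two_mul_card_definingSet (h : ℕ) (a : ZMod 2) :
    2 * ((definingSet F h a).card : ℤ) =
      Fintype.card F + (-1) ^ a.val * goldSum F h 1 + 2 * a.val - 2 := by
  classical
  have key : ∀ t : ZMod 2, 2 * (if t = a then 1 else 0 : ℤ) = 1 + (-1) ^ a.val * signChar t := by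
    revert a; decide
  have h1 : ∑ d : F, 2 * (if Algebra.trace (ZMod 2) F (d ^ (2 ^ h + 1) + d) = a then 1 else 0 : ℤ) =
      Fintype.card F + (-1) ^ a.val * goldSum F h 1 := by
    simp_rw [key, ← traceChar_apply]
    simp_rw [Finset.sum_add_distrib, ← Finset.mul_sum]
    unfold goldSum
    simp
  have h2 : (definingSet F h a) = (Finset.univ.filter fun d : F =>
      Algebra.trace (ZMod 2) F (d ^ (2 ^ h + 1) + d) = a).erase 0 := by
    ext d
    simp [definingSet]
  rw [← Finset.mul_sum, Finset.sum_boole] at h1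
  rw [h2, ← h1, Finset.card_erase_eq_ite]
  have ha : a = 0 ∨ a = 1 := (by decide : ∀ a : ZMod 2, a = 0 ∨ a = 1) a
  -- The excluded point `0` has trace value `0`, so it costs one element only when `a = 0`.
  rcases ha with rfl | rfl
  · have h0 : (0 : F) ∈ Finset.univ.filter fun d : F =>
      Algebra.trace (ZMod 2) F (d ^ (2 ^ h + 1) + d) = 0 := by simp
    rw [if_pos h0, Nat.cast_sub (Finset.card_pos.2 ⟨0, h0⟩)]
    simp
    ring
  · have h0 : (0 : F) ∉ Finset.univ.filter fun d : F =>
      Algebra.trace (ZMod 2) F (d ^ (2 ^ h + 1) + d) = 1 := by simp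
    rw [if_neg h0]
    simp [ZMod.val_one]

omit [Fintype F] in
theorem weightCount_traceCode {D : Finset F} (hD : Function.Injective (codeword D)) (i : ℕ) :
    weightCount (traceCode D) i = Nat.card {x // hammingNorm (codeword D x) = i} := by
  rw [weightCount, ← range_codeword]
  rw [show {c | c ∈ LinearMap.range (codeword D) ∧ hammingNorm c = i} =
    codeword D '' {x | hammingNorm (codeword D x) = i} by
      ext c
      constructor
      · rintro ⟨⟨x, rfl⟩, hx⟩
        exact ⟨x, hx, rfl⟩
      · rintro ⟨x, hx, rfl⟩
        exact ⟨⟨x, rfl⟩, hx⟩]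
  rw [Set.ncard_image_of_injective _ hD]
  rfl

end Code

theorem card_subtype_add_left {G : Type*} [AddGroup G] (g : G) (P : G → Prop) :
    Nat.card {x // P (g + x)} = Nat.card {x // P x} :=
  Nat.card_congr ((Equiv.addLeft g).subtypeEquiv fun _ => Iff.rfl)

theorem card_subtype_ne_and {G : Type*} [Finite G] {P : G → Prop} {g : G} (hg : P g) :
    (Nat.card {x // x ≠ g ∧ P x} : ℤ) = Nat.card {x // P x} - 1 := by
  classical
  have := Fintype.ofFinite G
  rw [Nat.card_eq_fintype_card, Nat.card_eq_fintype_card, Fintype.card_subtype,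
    Fintype.card_subtype, ← Finset.filter_filter, Finset.filter_ne', Finset.filter_erase,
    Finset.card_erase_of_mem (by simpa using hg), Nat.cast_sub
      (Finset.card_pos.2 ⟨g, by simpa using hg⟩)]
  simp

end TraceCode

/-! ### The weight distribution -/

open TraceCode in
theorem theorem1 {F : Type*} [Field F] [Fintype F] [Algebra (ZMod 2) F] (m h : ℕ)
    (hF : Fintype.card F = 2 ^ m) (hdvd : h ∣ m) (hlt : h < m) (hodd : Odd (m / h))
    (hm : m ≠ 3) (a : ZMod 2) :
    IsLinearCode (traceCode (definingSet F h a))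
      (2 ^ (m - 1) + (-1) ^ a.val * jacobiSym 2 (m / h) ^ h * 2 ^ ((m + h - 2) / 2) + a.val - 1)
      m ∧
    IsWeightCode (traceCode (definingSet F h a)) 3 ∧
    ∃ w₁ w₂ w₃ : ℕ,
      (w₁ : ℤ) = 2 ^ (m - 2) ∧
      (w₂ : ℤ) = 2 ^ (m - 2) + (-1) ^ a.val * jacobiSym 2 (m / h) ^ h * 2 ^ ((m + h - 2) / 2) ∧
      (w₃ : ℤ) = 2 ^ (m - 2) + (-1) ^ a.val * jacobiSym 2 (m / h) ^ h * 2 ^ ((m + h - 4) / 2) ∧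
      [0, w₁, w₂, w₃].Nodup ∧
      weightCount (traceCode (definingSet F h a)) 0 = 1 ∧
      (weightCount (traceCode (definingSet F h a)) w₁ : ℤ) =
        2 ^ (m - h - 1) - 1 + jacobiSym 2 (m / h) ^ h * 2 ^ ((m - h - 2) / 2) ∧
      (weightCount (traceCode (definingSet F h a)) w₂ : ℤ) =
        2 ^ (m - h - 1) - jacobiSym 2 (m / h) ^ h * 2 ^ ((m - h - 2) / 2) ∧
      (weightCount (traceCode (definingSet F h a)) w₃ : ℤ) = 2 ^ m - 2 ^ (m - h) ∧
      ∀ i : ℕ, i ≠ 0 → i ≠ w₁ → i ≠ w₂ → i ≠ w₃ →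
        weightCount (traceCode (definingSet F h a)) i = 0 := by
  classical
  have hh : 0 < h := Nat.pos_of_dvd_of_pos hdvd (by omega)
  obtain ⟨j, hj⟩ := hodd
  have hmj : m = h * (2 * j + 1) := by rw [← hj, Nat.mul_div_cancel' hdvd]
  have hF' := hmj ▸ hF
  have hG := goldSum_one h hh (2 * j + 1) j rfl F hF'
  rw [hj]
  set e : ℤ := jacobiSym 2 (2 * j + 1) ^ h with he_def
  have he : e = 1 ∨ e = -1 := by
    have : jacobiSym 2 (2 * j + 1) = 1 ∨ jacobiSym 2 (2 * j + 1) = -1 :=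
      jacobiSym.eq_one_or_neg_one (by
        have : Nat.Coprime 2 (2 * j + 1) := by simp
        exact_mod_cast this)
    rw [he_def]
    rcases this with h1 | h1 <;> rw [h1]
    · simp
    · exact neg_one_pow_eq_or ℤ h
  clear_value e
  obtain ⟨hc0, hc⟩ := card_goldSum_eq hh hF'
  have hmem := goldSum_mem hh hF'
  have hj0 : j ≠ 0 := by rintro rfl; simp at hmj; omega
  -- The only case with `h * j = 1` is `h = j = 1`, that is `m = 3`, where a weight could degenerate
  -- to zero.
  have hu : 2 ≤ h * j := by
    have h1 : 0 < h * j := by positivity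
    by_contra hlt2
    have h2 : h * j = 1 := by omega
    obtain rfl := Nat.eq_one_of_mul_eq_one_right h2
    obtain rfl := Nat.eq_one_of_mul_eq_one_left h2
    omega
  have hMe : h * (j + 1) = h * j + h := by ring
  have hme : h * (2 * j + 1) = 2 * (h * j) + h := by ring
  rw [hMe] at hG hc hmem
  rw [hme] at hmj hc0
  clear hF' hMe hme hj he_def
  generalize h * j = u at *
  have sgn : ((-1 : ℤ) ^ a.val = 1 ∨ (-1 : ℤ) ^ a.val = -1) := neg_one_pow_eq_or ℤ _
  have hwt := fun x (hx : x ≠ 0) => four_mul_hammingNorm_codeword (F := F) h a hx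
  have hlen := two_mul_card_definingSet (F := F) h a
  generalize hs : (-1 : ℤ) ^ a.val = s at *
  rw [hG, hF] at hlen
  simp only [hG, hF] at hwt
  -- As `m = 2u + h`, every halved exponent is exact, and all powers of 2 in the statement are
  -- monomials in `P` and `R`.
  obtain ⟨P, hP⟩ : ∃ P : ℤ, P = 2 ^ (u + h - 2) := ⟨_, rfl⟩
  obtain ⟨R, hR⟩ : ∃ R : ℤ, R = 2 ^ (u - 1) := ⟨_, rfl⟩
  have hP0 : 1 ≤ P := hP ▸ one_le_pow₀ (by norm_num)
  have hR0 : 2 ≤ R := by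
    rw [hR]
    exact le_self_pow₀ (by norm_num) (by omega)
  have eM : (2 : ℤ) ^ (u + h) = 4 * P := by
    rw [hP, show u + h = 2 + (u + h - 2) by omega, pow_add]; norm_num
  have eu : (2 : ℤ) ^ u = 2 * R := by
    rw [hR, ← pow_succ']; congr 1; omega
  have em : (2 : ℤ) ^ m = 8 * (R * P) := by
    rw [hmj, show 2 * u + h = u + (u + h) by ring, pow_add, eM, eu]; ring
  have em1 : (2 : ℤ) ^ (m - 1) = 4 * (R * P) := by
    have : (2 : ℤ) ^ m = 2 * 2 ^ (m - 1) := by rw [← pow_succ']; congr 1; omega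
    linarith
  have em2 : (2 : ℤ) ^ (m - 2) = 2 * (R * P) := by
    have : (2 : ℤ) ^ (m - 1) = 2 * 2 ^ (m - 2) := by rw [← pow_succ']; congr 1; omega
    linarith
  have e2u : (2 : ℤ) ^ (2 * u) = 4 * R ^ 2 := by rw [mul_comm, pow_mul, eu]; ring
  have emh1 : (2 : ℤ) ^ (m - h - 1) = 2 * R ^ 2 := by
    have : (2 : ℤ) ^ (2 * u) = 2 * 2 ^ (m - h - 1) := by rw [← pow_succ']; congr 1; omega
    linarith
  have emh : (2 : ℤ) ^ (m - h) = 4 * R ^ 2 := by rw [← e2u]; congr 1; omega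
  have emh2 : (2 : ℤ) ^ ((m - h - 2) / 2) = R := by rw [hR]; congr 1; omega
  have emp2 : (2 : ℤ) ^ ((m + h - 2) / 2) = 2 * P := by
    rw [hP, ← pow_succ']; congr 1; omega
  have emp4 : (2 : ℤ) ^ ((m + h - 4) / 2) = P := by rw [hP]; congr 1; omega
  have hRR : 2 * R ≤ R ^ 2 := by rw [sq]; exact mul_le_mul_of_nonneg_right hR0 (by linarith)
  have hRP : 2 * P ≤ R * P := mul_le_mul_of_nonneg_right hR0 (by linarith)
  have hPR : 2 * R ≤ 4 * P := by
    rw [← eu, ← eM]; exact pow_le_pow_right₀ (by norm_num) (by omega)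
  have hlt4 : 4 * R ^ 2 < 8 * (R * P) := by
    rw [← emh, ← em]; exact pow_lt_pow_right₀ (by norm_num) (by omega)
  rw [eM] at hlen hc hmem hG
  rw [← hmj, em, e2u] at hc0
  simp only [e2u, eu] at hc
  push_cast at hwt hlen
  simp only [em, eM] at hwt hlen
  rw [em, em1, em2, emh1, emh, emh2, emp2, emp4]
  have hse : s * e = 1 ∨ s * e = -1 := by
    rcases sgn with rfl | rfl <;> rcases he with rfl | rfl <;> simp
  -- A zero codeword with `x ≠ 0` would force `8RP ≤ 8P`, against `R ≥ 2`.
  have hinj : Function.Injective (codeword (definingSet F h a)) := by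
    rw [injective_iff_map_eq_zero]
    intro x hx
    by_contra hx0
    have := hwt x hx0
    rw [hx, hammingNorm_zero] at this
    rcases sgn with rfl | rfl <;> rcases he with rfl | rfl <;>
      rcases hmem (1 + x) with h1 | h1 | h1 <;> rw [h1] at this <;> push_cast at this <;> linarith
  have hss : s * s = 1 := by rcases sgn with rfl | rfl <;> rfl
  have hw0 : hammingNorm (codeword (definingSet F h a) (0 : F)) = 0 := by simp
  have hiff : ∀ (w : ℕ) (v : ℤ), w ≠ 0 → 4 * (w : ℤ) = 8 * (R * P) + s * (e * (4 * P) - v) →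
      ∀ x, hammingNorm (codeword (definingSet F h a) x) = w ↔ x ≠ 0 ∧ goldSum F h (1 + x) = v := by
    intro w v hw hwv x
    by_cases hx : x = 0
    · subst hx
      rw [hw0]
      simp [hw.symm]
    · have := hwt x hx
      rw [← Nat.cast_inj (R := ℤ)]
      constructor
      · intro h1
        refine ⟨hx, ?_⟩
        have h2 : s * goldSum F h (1 + x) = s * v := by linear_combination this - hwv - 4 * h1
        linear_combination s * h2 + (v - goldSum F h (1 + x)) * hss
      · rintro ⟨-, h1⟩
        rw [h1] at this
        linarith
  obtain ⟨w₁, hw₁⟩ := Int.eq_ofNat_of_zero_le (a := 2 * (R * P)) (by linarith)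
  obtain ⟨w₂, hw₂⟩ := Int.eq_ofNat_of_zero_le (a := 2 * (R * P) + s * e * (2 * P))
    (by rcases hse with h1 | h1 <;> rw [h1] <;> linarith)
  obtain ⟨w₃, hw₃⟩ := Int.eq_ofNat_of_zero_le (a := 2 * (R * P) + s * e * P)
    (by rcases hse with h1 | h1 <;> rw [h1] <;> linarith)
  have n1 : w₁ ≠ 0 := by rintro rfl; push_cast at hw₁; linarith
  have n2 : w₂ ≠ 0 := by
    rintro rfl; rcases hse with h1 | h1 <;> rw [h1] at hw₂ <;> push_cast at hw₂ <;> linarith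
  have n3 : w₃ ≠ 0 := by
    rintro rfl; rcases hse with h1 | h1 <;> rw [h1] at hw₃ <;> push_cast at hw₃ <;> linarith
  have n12 : w₁ ≠ w₂ := by
    rintro rfl; rcases hse with h1 | h1 <;> rw [h1] at hw₂ <;> linarith
  have n13 : w₁ ≠ w₃ := by
    rintro rfl; rcases hse with h1 | h1 <;> rw [h1] at hw₃ <;> linarith
  have n23 : w₂ ≠ w₃ := by
    rintro rfl; rcases hse with h1 | h1 <;> rw [h1] at hw₂ hw₃ <;> linarith
  -- The three weights correspond to `S(1+x)` being `S(1)`, `-S(1)` and `0`.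
  have i1 := hiff w₁ (e * (4 * P)) n1 (by linear_combination -4 * hw₁)
  have i2 := hiff w₂ (-e * (4 * P)) n2 (by linear_combination -4 * hw₂)
  have i3 := hiff w₃ 0 n3 (by linear_combination -4 * hw₃)
  have c0 : weightCount (traceCode (definingSet F h a)) 0 = 1 := by
    rw [weightCount_traceCode hinj, Nat.card_eq_one_iff_unique]
    refine ⟨⟨?_⟩, ⟨0, hw0⟩⟩
    have : ∀ x, hammingNorm (codeword (definingSet F h a) x) = 0 → x = 0 := fun x hx =>
      hinj (by rw [hammingNorm_eq_zero.1 hx, map_zero])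
    rintro ⟨x, hx⟩ ⟨y, hy⟩
    exact Subtype.ext ((this x hx).trans (this y hy).symm)
  -- Here `x = 0` also attains the value `S(1)` and must be removed, whence the `- 1`; for the other
  -- two values it never occurs.
  have c1 : (weightCount (traceCode (definingSet F h a)) w₁ : ℤ) = 2 * R ^ 2 - 1 + e * R := by
    rw [weightCount_traceCode hinj, Nat.card_congr (Equiv.subtypeEquivRight i1),
      card_subtype_ne_and (P := fun x => goldSum F h (1 + x) = e * (4 * P)) (by simpa using hG),
      card_subtype_add_left 1 fun x => goldSum F h x = e * (4 * P)]
    linarith [hc e he]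
  have hne : ∀ v : ℤ, v ≠ e * (4 * P) → ∀ x, x ≠ 0 ∧ goldSum F h (1 + x) = v ↔
      goldSum F h (1 + x) = v := by
    intro v hv x
    refine ⟨And.right, fun h1 => ⟨?_, h1⟩⟩
    rintro rfl
    rw [add_zero, hG] at h1
    exact hv h1.symm
  have c2 : (weightCount (traceCode (definingSet F h a)) w₂ : ℤ) = 2 * R ^ 2 - e * R := by
    rw [weightCount_traceCode hinj, Nat.card_congr (Equiv.subtypeEquivRight fun x =>
      (i2 x).trans (hne _ (by rcases he with rfl | rfl <;> intro h1 <;> linarith) x)),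
      card_subtype_add_left 1 fun x => goldSum F h x = -e * (4 * P)]
    have := hc (-e) (by rcases he with rfl | rfl <;> simp)
    linarith
  have c3 : (weightCount (traceCode (definingSet F h a)) w₃ : ℤ) = 8 * (R * P) - 4 * R ^ 2 := by
    rw [weightCount_traceCode hinj, Nat.card_congr (Equiv.subtypeEquivRight fun x =>
      (i3 x).trans (hne _ (by rcases he with rfl | rfl <;> intro h1 <;> linarith) x)),
      card_subtype_add_left 1 fun x => goldSum F h x = 0, hc0]
  have cn : ∀ i : ℕ, i ≠ 0 → i ≠ w₁ → i ≠ w₂ → i ≠ w₃ →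
      weightCount (traceCode (definingSet F h a)) i = 0 := by
    intro i h0 h1 h2 h3
    rw [weightCount_traceCode hinj, Nat.card_eq_zero]
    refine Or.inl ⟨?_⟩
    rintro ⟨x, hx⟩
    have hx0 : x ≠ 0 := by rintro rfl; exact h0 (hx ▸ hw0)
    by_cases g1 : goldSum F h (1 + x) = e * (4 * P)
    · exact h1 (hx ▸ (i1 x).2 ⟨hx0, g1⟩)
    by_cases g2 : goldSum F h (1 + x) = -e * (4 * P)
    · exact h2 (hx ▸ (i2 x).2 ⟨hx0, g2⟩)
    refine h3 (hx ▸ (i3 x).2 ⟨hx0, ?_⟩)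
    rcases hmem (1 + x) with g | g | g
    · exact g
    · rcases he with rfl | rfl <;> simp [g] at g1 g2
    · rcases he with rfl | rfl <;> simp [g] at g1 g2
  refine ⟨⟨?_, ?_⟩, ?_, w₁, w₂, w₃, hw₁.symm, hw₂.symm, hw₃.symm, ?_, c0, c1, c2, c3, cn⟩
  · rw [Fintype.card_coe]
    linarith
  · rw [← range_codeword, LinearMap.finrank_range_of_inj hinj]
    have := Module.card_eq_pow_finrank (K := ZMod 2) (V := F)
    rw [hF, ZMod.card] at this
    exact_mod_cast (Nat.pow_right_injective le_rfl this).symm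
  · rw [IsWeightCode, Set.ncard_eq_three]
    refine ⟨w₁, w₂, w₃, n12, n13, n23, ?_⟩
    have hle : ∀ i, weightCount (traceCode (definingSet F h a)) i ≠ 0 →
        i ≤ Fintype.card (definingSet F h a) := by
      intro i hi
      obtain ⟨c, -, rfl⟩ := Set.nonempty_of_ncard_ne_zero hi
      exact hammingNorm_le_card_fintype
    have p1 : weightCount (traceCode (definingSet F h a)) w₁ ≠ 0 := by
      rw [← Nat.cast_ne_zero (R := ℤ), c1]
      rcases he with rfl | rfl <;> linarith
    have p2 : weightCount (traceCode (definingSet F h a)) w₂ ≠ 0 := by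
      rw [← Nat.cast_ne_zero (R := ℤ), c2]
      rcases he with rfl | rfl <;> linarith
    have p3 : weightCount (traceCode (definingSet F h a)) w₃ ≠ 0 := by
      rw [← Nat.cast_ne_zero (R := ℤ), c3]
      linarith
    ext i
    simp only [Set.mem_ofPred_eq, Set.mem_insert_iff, Set.mem_singleton_iff]
    constructor
    · rintro ⟨h1, -, h3⟩
      by_contra hcon
      push Not at hcon
      exact h3 (cn i (by omega) hcon.1 hcon.2.1 hcon.2.2)
    · rintro (rfl | rfl | rfl)
      · exact ⟨by omega, hle _ p1, p1⟩
      · exact ⟨by omega, hle _ p2, p2⟩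
      · exact ⟨by omega, hle _ p3, p3⟩
  · simp [n1.symm, n2.symm, n3.symm, n12, n13, n23]
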